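/- **Setting.** Let $\Omega=\{1,\dots,Q\}$ and let $N\ge 1$. For $r,q\in\Omega$ let $(h_{rq}(l))_{l=0}^{L_h}$ be a complex FIR impulse response, $d_{rq}>0$ a distance, and $\gamma\in\mathbb R$ the path-loss exponent. The channel matrix $\mathbf H_{rq}\in\mathbb C^{N\times N}$ from source $r$ to destination $q$ is the circulant matrix of the cyclic convolution with $h_{rq}$ modulo $N$, divided by $\sqrt{d_{rq}^{\gamma}}$, and $\bar H_{rq}(k)=\sum_l h_{rq}(l)e^{-2\pi \mathrm i\, l(k-1)/N}$, $k=1,\dots,N$. Let $\mathbf W$ be the normalized IFFT matrix, $[\mathbf W]_{ij}=e^{2\pi \mathrm i(i-1)(j-1)/N}/\sqrt N$. Let $\sigma_q^2>0$ (noise variance), $P_q>0$ (power budget), $\overline p_q^{\max}(k)\ge 0$ (spectral mask) and $\Gamma_q\ge 1$ (gap). Put $\mathbf R_{-q}=\sigma_q^2\mathbf I+\sum_{r\ne q}\mathbf H_{rq}\mathbf F_r\mathbf F_r^H\mathbf H_{rq}^H$ and $\mathbf M_q=\mathbf I+\mathbf F_q^H\mathbf H_{qq}^H\mathbf R_{-q}^{-1}\mathbf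 H_{qq}\mathbf F_q$. In the matrix games $\mathscr G_1$ and $\mathscr G_2$ player $q\in\Omega$ chooses $\mathbf F_q$ in $$\mathscr F_q=\Big\{\mathbf F\in\mathbb C^{N\times N}:\tfrac1N\mathrm{Tr}(\mathbf F\mathbf F^H)\le P_q,\ [\mathbf W^H\mathbf F\mathbf F^H\mathbf W]_{kk}\le\overline p_q^{\max}(k)\ \ \forall k\Big\}.$$ The payoff in $\mathscr G_1$ is the mutual information $\frac1N\log\det\mathbf M_q$. The payoff in $\mathscr G_2$ is the gap-approximated rate $\frac1N\sum_{k}\log_2\big(1+\mathrm{SINR}_{k,q}/\Gamma_q\big)$, where $\mathrm{SINR}_{k,q}=1/[\mathbf M_q^{-1}]_{kk}-1$ is the SINR after the MMSE receiver. In the vector game $\mathscr G$ player $q$ chooses $\mathbf p_q$ in $$\mathscr P_q=\Big\{\mathbf p\in\mathbb R^N:\tfrac1N\sum_k p(k)\le 1,\ 0\le p(k)\le \overline p_q^{\max}(k)/P_q\ \ \forall k\Big\}$$ and has payoff $R_q(\mathbf p)=\frac1N\sum_k\log\big(1+\mathsf{sinr}_q(k)/\Gamma_q\big)$, where $$\mathsf{sinr}_q(k)=\frac{P_q|\bar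 H_{qq}(k)|^2p_q(k)/d_{qq}^\gamma}{\sigma_q^2+\sum_{r\ne q}P_r|\bar H_{rq}(k)|^2p_r(k)/d_{rq}^\gamma}.$$ Here $\log$ is the natural logarithm, and $\Gamma_q=1$ for all $q$ in $\mathscr G$ when it is compared with $\mathscr G_1$. A *solution* of a game is a pure-strategy Nash equilibrium; a *best response* of player $q$ in a profile is an admissible strategy of $q$ that maximizes the payoff of $q$ over all admissible strategies of $q$, those of the others being fixed. For $\mathbf p=(\mathbf p_q)_{q\in\Omega}$ with nonnegative entries put $$\mathbf F_q(\mathbf p_q)=\mathbf W\sqrt{P_q\,\mathrm{diag}(\mathbf p_q)},\qquad q\in\Omega .$$ **Theorem.** For every $\mathbf p$ with nonnegative entries, $\mathbf F_q(\mathbf p_q)\in\mathscr F_q$ if and only if $\mathbf p_q\in\mathscr P_q$. For every real $\mathbf p$, $$\mathsf{sinr}_q(k)=\frac{|H_{qq}(k)|^2p_q(k)}{1+\sum_{r\neq q}|H_{rq}(k)|^2p_r(k)},\qquad H_{rq}(k)=\bar H_{rq}(k)\sqrt{P_r/(\sigma_q^2d_{rq}^\gamma)}.$$ Moreover, for each of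 the games $\mathscr G_1$ and $\mathscr G_2$: 1. (Same payoffs.) For every $\mathbf p$ with nonnegative entries, the payoff of each user $q$ at $(\mathbf F_r(\mathbf p_r))_{r}$ is $R_q(\mathbf p)$ in $\mathscr G_1$, and $R_q(\mathbf p)/\log 2$ (that is, $R_q$ in bits) in $\mathscr G_2$. 2. (Optimal precoders.) For every $\mathbf p$ with nonnegative entries and every user $q$, the precoder $\mathbf F_q(\mathbf p_q)$ is a best response of $q$, among all precoding matrices in $\mathscr F_q$, to $(\mathbf F_r(\mathbf p_r))_{r\ne q}$ if and only if $\mathbf p_q$ is a best response to $(\mathbf p_r)_{r\neq q}$ in $\mathscr G$. If $\mathbf p_r\in\mathscr P_r$ for all $r$, then for every $q$ there is $\mathbf y\in\mathscr P_q$ which is a best response to $(\mathbf p_r)_{r\neq q}$ in $\mathscr G$, so that $\mathbf F_q(\mathbf y)$ is a best response to $(\mathbf F_r(\mathbf p_r))_{r\ne q}$ in the matrix game. 3. (Solutions.) For every $\mathbf p$ with nonnegative entries, $(\mathbf F_q(\mathbf p_q))_{q\in\Omega}$ is a solution of the matrix game if and only if $\mathbf p$ is a solution of $\mathscr G$. 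-/

import Mathlib

open scoped Matrix

/-- A strategic game with set of players `ι`, all of whose strategies live in a common type `A`:
`strategies q` is the admissible set of player `q` and `payoff q x` is what player `q` gets
under the strategy profile `x`. -/
structure StrategicGame (ι A : Type) where
  strategies : ι → Set A
  payoff : ι → (ι → A) → ℝ

/-- In the profile `x` player `q` plays an admissible strategy that is optimal against the
strategies that the other players have in `x`. -/
def StrategicGame.IsBestResponse {ι A : Type} [DecidableEq ι] (G : StrategicGame ι A)
    (x : ι → A) (q : ι) : Prop :=
  x q ∈ G.strategies q ∧
    ∀ y ∈ G.strategies q, G.payoff q (Function.update x q y) ≤ G.payoff q x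

/-- Pure-strategy Nash equilibrium. -/
def StrategicGame.IsNash {ι A : Type} [DecidableEq ι] (G : StrategicGame ι A)
    (x : ι → A) : Prop :=
  ∀ q, G.IsBestResponse x q

/-- The physical data of `Q` links which transmit blocks of length `N` over frequency-selective
channels. In arguments `r q`, `r` is the source and `q` the destination. -/
structure LinkSystem (Q N : ℕ) where
  /-- maximum order of the FIR channels -/
  order : ℕ
  /-- impulse response (normalized fading) of the channel from source `r` to destination `q` -/
  tap : Fin Q → Fin Q → Fin (order + 1) → ℂ
  /-- distance between source `r` and destination `q` -/
  dist : Fin Q → Fin Q → ℝ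
  dist_pos : ∀ r q, 0 < dist r q
  /-- path-loss exponent -/
  pathExp : ℝ
  /-- `noise q ^ 2` is the noise variance at destination `q` -/
  noise : Fin Q → ℝ
  noise_pos : ∀ q, 0 < noise q
  /-- power budget -/
  power : Fin Q → ℝ
  power_pos : ∀ q, 0 < power q
  /-- spectral mask, not normalized -/
  mask : Fin Q → Fin N → ℝ
  mask_nonneg : ∀ q k, 0 ≤ mask q k

noncomputable section

/-- The normalized IFFT matrix, with entries `exp (2 π i a b / N) / √N` for `a, b = 0, …, N - 1`. -/
def ifftMatrix (N : ℕ) : Matrix (Fin N) (Fin N) ℂ :=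
  Matrix.of fun a b =>
    Complex.exp (2 * Real.pi * Complex.I * (a : ℕ) * (b : ℕ) / N) / (Real.sqrt N : ℂ)

namespace LinkSystem

variable {Q N : ℕ}

/-- Path loss `d_rq ^ γ`. -/
def pathLoss (S : LinkSystem Q N) (r q : Fin Q) : ℝ := S.dist r q ^ S.pathExp

/-- The channel matrix left after insertion and removal of the cyclic prefix: the circulant matrix
of the cyclic convolution `x ↦ (i ↦ ∑ l, h l * x (i - l mod N))`, scaled by the path loss. -/
def channel (S : LinkSystem Q N) (r q : Fin Q) : Matrix (Fin N) (Fin N) ℂ :=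
  Matrix.of fun i j =>
    ∑ l : Fin (S.order + 1),
      if ((j : ℕ) + (l : ℕ)) ≡ (i : ℕ) [MOD N] then
        S.tap r q l / (Real.sqrt (S.pathLoss r q) : ℂ)
      else 0

/-- Frequency response of the normalized fading channel on the `k`-th frequency bin. -/
def freqResp (S : LinkSystem Q N) (r q : Fin Q) (k : Fin N) : ℂ :=
  ∑ l : Fin (S.order + 1),
    S.tap r q l * Complex.exp (-(2 * Real.pi * Complex.I * (l : ℕ) * (k : ℕ) / N))

/-- Interference-plus-noise covariance matrix observed by user `q` under the precoders `F`. -/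
def interfCov (S : LinkSystem Q N) (F : Fin Q → Matrix (Fin N) (Fin N) ℂ) (q : Fin Q) :
    Matrix (Fin N) (Fin N) ℂ :=
  ((S.noise q ^ 2 : ℝ) : ℂ) • (1 : Matrix (Fin N) (Fin N) ℂ) +
    ∑ r ∈ Finset.univ.erase q, S.channel r q * F r * (F r)ᴴ * (S.channel r q)ᴴ

/-- The matrix `I + F_qᴴ H_qqᴴ R_{-q}⁻¹ H_qq F_q`. -/
def gainMatrix (S : LinkSystem Q N) (F : Fin Q → Matrix (Fin N) (Fin N) ℂ) (q : Fin Q) :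
    Matrix (Fin N) (Fin N) ℂ :=
  1 + (F q)ᴴ * (S.channel q q)ᴴ * (S.interfCov F q)⁻¹ * S.channel q q * F q

/-- Mutual information of link `q`, the other users being treated as noise (the determinant
is a positive real number). -/
def mutualInfo (S : LinkSystem Q N) (F : Fin Q → Matrix (Fin N) (Fin N) ℂ) (q : Fin Q) : ℝ :=
  1 / N * Real.log (S.gainMatrix F q).det.re

/-- SINR of link `q` on the `k`-th substream after the MMSE (Wiener) receiver (the diagonal
entries of the inverse are positive real numbers). -/
def mmseSINR (S : LinkSystem Q N) (F : Fin Q → Matrix (Fin N) (Fin N) ℂ) (q : Fin Q)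
    (k : Fin N) : ℝ :=
  1 / ((S.gainMatrix F q)⁻¹ k k).re - 1

/-- Transmission rate of link `q`, in bits, under the gap approximation with gaps `Γ`. -/
def gapRate (S : LinkSystem Q N) (Γ : Fin Q → ℝ) (F : Fin Q → Matrix (Fin N) (Fin N) ℂ)
    (q : Fin Q) : ℝ :=
  1 / N * ∑ k, Real.logb 2 (1 + S.mmseSINR F q k / Γ q)

/-- Precoding matrices satisfying the transmit power and the spectral mask constraints. -/
def precoders (S : LinkSystem Q N) (q : Fin Q) : Set (Matrix (Fin N) (Fin N) ℂ) :=
  {F | 1 / N * (F * Fᴴ).trace.re ≤ S.power q ∧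
    ∀ k, (((ifftMatrix N)ᴴ * F * Fᴴ * ifftMatrix N) k k).re ≤ S.mask q k}

/-- The matrix game whose payoffs are the mutual informations. -/
def game1 (S : LinkSystem Q N) : StrategicGame (Fin Q) (Matrix (Fin N) (Fin N) ℂ) where
  strategies := S.precoders
  payoff := fun q F => S.mutualInfo F q

/-- The matrix game whose payoffs are the gap-approximated transmission rates. -/
def game2 (S : LinkSystem Q N) (Γ : Fin Q → ℝ) :
    StrategicGame (Fin Q) (Matrix (Fin N) (Fin N) ℂ) where
  strategies := S.precoders
  payoff := fun q F => S.gapRate Γ F q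

/-- The signal to interference-plus-noise ratio of user `q` on the `k`-th bin. -/
def sinr (S : LinkSystem Q N) (p : Fin Q → Fin N → ℝ) (q : Fin Q) (k : Fin N) : ℝ :=
  (S.power q * ‖S.freqResp q q k‖ ^ 2 * p q k / S.pathLoss q q) /
    (S.noise q ^ 2 + ∑ r ∈ Finset.univ.erase q,
      S.power r * ‖S.freqResp r q k‖ ^ 2 * p r k / S.pathLoss r q)

/-- The normalized channel `H_rq(k)`. -/
def normResp (S : LinkSystem Q N) (r q : Fin Q) (k : Fin N) : ℂ :=
  S.freqResp r q k * (Real.sqrt (S.power r / (S.noise q ^ 2 * S.pathLoss r q)) : ℂ)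

/-- Admissible (normalized) power allocations of user `q`. -/
def allocations (S : LinkSystem Q N) (q : Fin Q) : Set (Fin N → ℝ) :=
  {p | 1 / N * ∑ k, p k ≤ 1 ∧ ∀ k, 0 ≤ p k ∧ p k ≤ S.mask q k / S.power q}

/-- The vector power-control game with gaps `Γ`. -/
def vectorGame (S : LinkSystem Q N) (Γ : Fin Q → ℝ) : StrategicGame (Fin Q) (Fin N → ℝ) where
  strategies := S.allocations
  payoff := fun q p => 1 / N * ∑ k, Real.log (1 + 1 / Γ q * S.sinr p q k)

/-- The channel-diagonalizing precoders `W √(diag (P_q p_q))`. Here `p_q` is normalized by the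
power budget `P_q`, so that `P_q p_q(k)` is the power which user `q` puts on the `k`-th bin. -/
def diagPrecoder (S : LinkSystem Q N) (p : Fin Q → Fin N → ℝ) (q : Fin Q) :
    Matrix (Fin N) (Fin N) ℂ :=
  ifftMatrix N * Matrix.diagonal fun k => (Real.sqrt (S.power q * p q k) : ℂ)

end LinkSystem

end

/-! Conjugation by the unitary IFFT matrix `W` diagonalizes every circulant channel. If the
interferers use diagonal precoders `W √diag`, the interference covariance is diagonal in the same
basis, and with `G = Wᴴ F_q` the gain matrix is `1 + Gᴴ D G`, where `D` is the diagonal matrix of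
the nonnegative channel gains (`gainMatrix_eq`). Both constraints see `F_q` only through the
diagonal of `G Gᴴ`, the bin powers (`mem_precoders_iff`).

It remains to see that, for given bin powers, no precoder beats the diagonal one. For the mutual
information, `det (1 + Gᴴ D G) = det (1 + √D G Gᴴ √D)`, and Hadamard's inequality bounds this by the
product over the bins. For the gap rate, put `K = Gᴴ D G`. The substream errors are the diagonal of
`(1 + K)⁻¹` and the rate is convex in the error, so Jensen's inequality along the spectral
decomposition gives at most `log det (1 + K / Γ)`; this is the first case with gains divided by `Γ`.

Thus every deviation is dominated by an equally admissible diagonal one, and best responses and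
equilibria transfer (`optimality_of_payoff_le`). Existence of best responses is compactness of the
allocation set. -/

/-! ### Convexity and determinant inequalities for Hermitian matrices. -/

section MatrixInequalities

open scoped ComplexOrder

variable {n : Type*} [Fintype n] [DecidableEq n]

/-- The diagonal of a Hermitian matrix is obtained from its eigenvalues by a doubly stochastic
matrix, so that separable convex functions do not increase on passing to the diagonal. -/
lemma Matrix.sum_map_diag_le_of_convexOn {U : Matrix n n ℂ} (hU : U * Uᴴ = 1) (d : n → ℝ)
    {s : Set ℝ} {f : ℝ → ℝ} (hf : ConvexOn ℝ s f) (hd : ∀ j, d j ∈ s) :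
    ∑ k, f ((U * diagonal (fun j => (d j : ℂ)) * Uᴴ) k k).re ≤ ∑ j, f (d j) := by
  have hU' : Uᴴ * U = 1 := mul_eq_one_comm.mp hU
  have row (k : n) : ∑ j, Complex.normSq (U k j) = 1 := by
    have h := congrFun (congrFun hU k) k
    simp only [mul_apply, conjTranspose_apply, one_apply_eq, RCLike.star_def,
      Complex.mul_conj] at h
    exact_mod_cast h
  have col (j : n) : ∑ k, Complex.normSq (U k j) = 1 := by
    have h := congrFun (congrFun hU' j) j
    simp only [mul_apply, conjTranspose_apply, one_apply_eq, RCLike.star_def,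
      mul_comm ((starRingEnd ℂ) _), Complex.mul_conj] at h
    exact_mod_cast h
  have diag (k : n) : ((U * diagonal (fun j => (d j : ℂ)) * Uᴴ) k k).re =
      ∑ j, Complex.normSq (U k j) * d j := by
    have h : (U * diagonal (fun j => (d j : ℂ)) * Uᴴ) k k =
        ((∑ j, Complex.normSq (U k j) * d j : ℝ) : ℂ) := by
      rw [mul_apply]
      push_cast
      refine Finset.sum_congr rfl fun j _ => ?_
      rw [mul_diagonal, conjTranspose_apply, ← Complex.mul_conj, RCLike.star_def]
      ring
    rw [h, Complex.ofReal_re]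
  calc ∑ k, f ((U * diagonal (fun j => (d j : ℂ)) * Uᴴ) k k).re
      ≤ ∑ k, ∑ j, Complex.normSq (U k j) * f (d j) := by
        refine Finset.sum_le_sum fun k _ => ?_
        rw [diag k]
        -- Jensen's inequality: the squared moduli in a row are convex weights. The column sums then
        -- collapse the double sum.
        exact hf.map_sum_le (fun j _ => Complex.normSq_nonneg _) (row k) (fun j _ => hd j)
    _ = ∑ j, f (d j) := by
        rw [Finset.sum_comm]
        simp_rw [← Finset.sum_mul, col, one_mul]

/-- The spectral theorem, in the form that `sum_map_diag_le_of_convexOn` takes as input. -/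
lemma Matrix.IsHermitian.eq_mul_diagonal_mul {A : Matrix n n ℂ} (hA : A.IsHermitian) :
    ∃ U : Matrix n n ℂ, U * Uᴴ = 1 ∧
      A = U * diagonal (fun j => (hA.eigenvalues j : ℂ)) * Uᴴ := by
  refine ⟨hA.eigenvectorUnitary, Unitary.coe_mul_star_self _, ?_⟩
  conv_lhs => rw [hA.spectral_theorem, Unitary.conjStarAlgAut_apply]
  rfl

/-- Hadamard's inequality, in logarithmic form. -/
lemma Matrix.PosDef.log_det_le_sum_log_diag {A : Matrix n n ℂ} (hA : A.PosDef) :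
    Real.log A.det.re ≤ ∑ k, Real.log (A k k).re := by
  obtain ⟨U, hU, hAU⟩ := hA.isHermitian.eq_mul_diagonal_mul
  have h := sum_map_diag_le_of_convexOn hU hA.isHermitian.eigenvalues
    (s := Set.Ioi 0) (f := fun x => -Real.log x)
    strictConcaveOn_log_Ioi.concaveOn.neg (fun j => hA.eigenvalues_pos j)
  rw [← hAU] at h
  have hdet : A.det.re = ∏ j, hA.isHermitian.eigenvalues j := by
    rw [hA.isHermitian.det_eq_prod_eigenvalues]
    exact_mod_cast Complex.ofReal_re (∏ j, hA.isHermitian.eigenvalues j)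
  rw [hdet, Real.log_prod fun j _ => (hA.eigenvalues_pos j).ne']
  simpa using h

lemma one_add_inv_sub_one_div_pos {a x : ℝ} (ha : 1 ≤ a) (hx : 0 < x) :
    0 < 1 + (1 / x - 1) / a := by
  have ha0 : 0 < a := by linarith
  have : 1 + (1 / x - 1) / a = ((a - 1) * x + 1) / (a * x) := by field_simp; ring
  rw [this]
  have : 0 ≤ (a - 1) * x := mul_nonneg (by linarith) hx.le
  positivity

/-- The gap-approximated rate is a convex function of the mean square error. -/
lemma convexOn_log_one_add_inv_sub_one_div {a : ℝ} (ha : 1 ≤ a) :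
    ConvexOn ℝ (Set.Ioi 0) fun x : ℝ => Real.log (1 + (1 / x - 1) / a) := by
  have ha0 : 0 < a := by linarith
  -- Supporting line at `y`: the derivative there is `-1 / (y * ((a - 1) * y + 1))`. This avoids
  -- second derivatives.
  have tangent (x y : ℝ) (hx : 0 < x) (hy : 0 < y) :
      Real.log (1 + (1 / y - 1) / a) - (x - y) / (y * ((a - 1) * y + 1)) ≤
        Real.log (1 + (1 / x - 1) / a) := by
    have px := one_add_inv_sub_one_div_pos ha hx
    have py := one_add_inv_sub_one_div_pos ha hy
    have h1 := Real.log_le_sub_one_of_pos (div_pos py px)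
    rw [Real.log_div py.ne' px.ne'] at h1
    have hx' : 0 < (a - 1) * x + 1 := by nlinarith
    have hy' : 0 < (a - 1) * y + 1 := by nlinarith
    have h2 : (1 + (1 / y - 1) / a) / (1 + (1 / x - 1) / a) - 1 =
        (x - y) / (y * ((a - 1) * x + 1)) := by
      have ex : 1 + (1 / x - 1) / a = ((a - 1) * x + 1) / (a * x) := by field_simp; ring
      have ey : 1 + (1 / y - 1) / a = ((a - 1) * y + 1) / (a * y) := by field_simp; ring
      rw [ex, ey]
      field_simp
      ring
    -- The bound `log t ≤ t - 1` leaves `x` in the denominator; replacing it by `y` costs a multiple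
    -- of `(a - 1) * (x - y) ^ 2`, which has the right sign because `1 ≤ a`.
    have h3 : (x - y) / (y * ((a - 1) * x + 1)) ≤ (x - y) / (y * ((a - 1) * y + 1)) := by
      rw [← sub_nonneg]
      have : (x - y) / (y * ((a - 1) * y + 1)) - (x - y) / (y * ((a - 1) * x + 1)) =
          (a - 1) * (x - y) ^ 2 / (y * ((a - 1) * y + 1) * ((a - 1) * x + 1)) := by
        rw [div_sub_div _ _ (by positivity) (by positivity),
          div_eq_div_iff (by positivity) (by positivity)]
        ring
      rw [this]
      have : 0 ≤ a - 1 := by linarith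
      positivity
    linarith
  refine ⟨convex_Ioi 0, fun x hx y hy b c hb hc hbc => ?_⟩
  have hz : 0 < b • x + c • y := convex_Ioi (0 : ℝ) hx hy hb hc hbc
  have h1 := mul_le_mul_of_nonneg_left (tangent x _ hx hz) hb
  have h2 := mul_le_mul_of_nonneg_left (tangent y _ hy hz) hc
  set z := b • x + c • y with hzdef
  -- At the barycentre `z` the linear terms of the two supporting lines cancel.
  have h3 : b * ((x - z) / (z * ((a - 1) * z + 1))) +
      c * ((y - z) / (z * ((a - 1) * z + 1))) = 0 := by
    have : b * (x - z) + c * (y - z) = 0 := by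
      simp only [smul_eq_mul] at hzdef
      linear_combination -hzdef - z * hbc
    rw [← mul_div_assoc, ← mul_div_assoc, ← add_div, this, zero_div]
  have h4 : b * Real.log (1 + (1 / z - 1) / a) + c * Real.log (1 + (1 / z - 1) / a) =
      Real.log (1 + (1 / z - 1) / a) := by rw [← add_mul, hbc, one_mul]
  simp only [smul_eq_mul]
  linarith

/-- The sum of the gap-approximated rates of the substreams does not exceed the log-determinant
bound. -/
lemma Matrix.PosSemidef.sum_log_gap_le_log_det {K : Matrix n n ℂ} (hK : K.PosSemidef) {a : ℝ}
    (ha : 1 ≤ a) :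
    ∑ k, Real.log (1 + (1 / ((1 + K)⁻¹ k k).re - 1) / a) ≤
      Real.log (1 + ((1 / a : ℝ) : ℂ) • K).det.re := by
  have ha0 : 0 < a := by linarith
  obtain ⟨U, hU, hKU⟩ := hK.isHermitian.eq_mul_diagonal_mul
  set μ := hK.isHermitian.eigenvalues
  have hμ (j : n) : 0 ≤ μ j := hK.eigenvalues_nonneg j
  have hU' : Uᴴ * U = 1 := mul_eq_one_comm.mp hU
  have one_add (c : ℝ) : 1 + (c : ℂ) • K =
      U * diagonal (fun j => ((1 + c * μ j : ℝ) : ℂ)) * Uᴴ := by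
    have : diagonal (fun j => ((1 + c * μ j : ℝ) : ℂ)) =
        (1 : Matrix n n ℂ) + (c : ℂ) • diagonal (fun j => (μ j : ℂ)) := by
      ext i j
      by_cases h : i = j <;> simp [h]
    rw [this, mul_add, add_mul, mul_one, hU, Matrix.mul_smul, Matrix.smul_mul, ← hKU]
  have inv : (1 + K)⁻¹ = U * diagonal (fun j => ((1 / (1 + μ j) : ℝ) : ℂ)) * Uᴴ := by
    have h := one_add 1
    simp only [Complex.ofReal_one, one_smul, one_mul] at h
    refine inv_eq_right_inv ?_
    rw [h]
    calc _ = U * (diagonal (fun j => ((1 + μ j : ℝ) : ℂ)) * (Uᴴ * U) *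
          diagonal (fun j => ((1 / (1 + μ j) : ℝ) : ℂ))) * Uᴴ := by simp only [mul_assoc]
      _ = 1 := by
        have : (fun j => ((1 + μ j : ℝ) : ℂ) * ((1 / (1 + μ j) : ℝ) : ℂ)) = fun _ => 1 := by
          ext j
          have : 1 + μ j ≠ 0 := by linarith [hμ j]
          rw [← Complex.ofReal_mul, mul_one_div_cancel this, Complex.ofReal_one]
        rw [hU', mul_one, diagonal_mul_diagonal, this, diagonal_one, mul_one, hU]
  have hdet : (1 + ((1 / a : ℝ) : ℂ) • K).det.re = ∏ j, (1 + 1 / a * μ j) := by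
    rw [one_add, det_mul_right_comm, hU, one_mul, det_diagonal]
    exact_mod_cast Complex.ofReal_re (∏ j, (1 + 1 / a * μ j))
  have hpos (j : n) : 0 < 1 + 1 / a * μ j := by have := hμ j; positivity
  rw [hdet, Real.log_prod fun j _ => (hpos j).ne', inv]
  refine (sum_map_diag_le_of_convexOn hU _ (convexOn_log_one_add_inv_sub_one_div ha)
    fun j => ?_).trans_eq (Finset.sum_congr rfl fun j _ => ?_)
  · have := hμ j
    exact Set.mem_Ioi.mpr (by positivity)
  -- At the error `1 / (1 + μ)` the convex function takes the value `log (1 + μ / a)`.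
  · congr 1
    field_simp
    ring

/-- Hadamard's inequality for `1 + Gᴴ * diagonal d * G`. -/
lemma Matrix.log_det_one_add_conjTranspose_mul_diagonal_mul_le (G : Matrix n n ℂ) {d : n → ℝ}
    (hd : ∀ k, 0 ≤ d k) :
    Real.log (1 + Gᴴ * diagonal (fun k => (d k : ℂ)) * G).det.re ≤
      ∑ k, Real.log (1 + d k * ((G * Gᴴ) k k).re) := by
  set T : Matrix n n ℂ := diagonal fun k => (Real.sqrt (d k) : ℂ) with hT
  have hTT : diagonal (fun k => (d k : ℂ)) = T * T := by
    rw [hT, diagonal_mul_diagonal]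
    congr 1; ext k
    rw [← Complex.ofReal_mul, Real.mul_self_sqrt (hd k)]
  have hTH : Tᴴ = T := by
    rw [hT, diagonal_conjTranspose]
    congr 1; ext k
    simp
  -- Sylvester's identity moves `G` to the other side, so that the diagonal used by Hadamard's
  -- inequality involves only `G * Gᴴ`.
  have hdet : (1 + Gᴴ * diagonal (fun k => (d k : ℂ)) * G).det =
      (1 + (T * G) * (T * G)ᴴ).det := by
    rw [conjTranspose_mul, hTH, det_one_add_mul_comm (T * G), hTT]
    simp only [mul_assoc]
  have hpd : (1 + (T * G) * (T * G)ᴴ).PosDef :=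
    PosDef.one.add_posSemidef (posSemidef_self_mul_conjTranspose _)
  rw [hdet]
  refine hpd.log_det_le_sum_log_diag.trans_eq (Finset.sum_congr rfl fun k _ => ?_)
  congr 1
  have : (T * G) * (T * G)ᴴ = T * (G * Gᴴ) * T := by
    rw [conjTranspose_mul, hTH]; simp only [mul_assoc]
  rw [this, add_apply, one_apply_eq, hT, mul_diagonal, diagonal_mul, Complex.add_re,
    Complex.one_re, Complex.re_mul_ofReal, Complex.re_ofReal_mul]
  congr 1
  nth_rewrite 3 [← Real.mul_self_sqrt (hd k)]
  ring

end MatrixInequalities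

/-! ### The discrete Fourier basis and arithmetic modulo `N`. -/

section Fourier

variable {N : ℕ} [NeZero N]

open Matrix

/-- Orthogonality of characters: the inner product of columns `b` and `c` is a geometric sum with
ratio `z = ζ ^ (c - b)`, an `N`-th root of unity that equals `1` only when `b = c`. -/
lemma ifftMatrix_conjTranspose_mul_self : (ifftMatrix N)ᴴ * ifftMatrix N = 1 := by
  have hN : (N : ℂ) ≠ 0 := Nat.cast_ne_zero.mpr (NeZero.ne N)
  set ζ : ℂ := Complex.exp (2 * Real.pi * Complex.I / N) with hζ
  have hprim : IsPrimitiveRoot ζ N := Complex.isPrimitiveRoot_exp N (NeZero.ne N)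
  have hζ0 : ζ ≠ 0 := Complex.exp_ne_zero _
  have entry (a b : Fin N) : ifftMatrix N a b = (ζ ^ (b : ℕ)) ^ (a : ℕ) / (Real.sqrt N : ℂ) := by
    rw [← pow_mul, hζ, ← Complex.exp_nat_mul, ifftMatrix, of_apply]
    congr 2
    push_cast
    ring
  have hconj : (starRingEnd ℂ) ζ = ζ⁻¹ := by
    rw [hζ, ← Complex.exp_conj, ← Complex.exp_neg]
    congr 1
    rw [map_div₀, map_mul, map_mul, Complex.conj_ofReal, Complex.conj_I, map_natCast,
      map_ofNat]
    ring
  have hsq : (Real.sqrt N : ℂ) * (Real.sqrt N : ℂ) = N := by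
    rw [← Complex.ofReal_mul, Real.mul_self_sqrt (Nat.cast_nonneg N), Complex.ofReal_natCast]
  ext b c
  set z : ℂ := (ζ ^ (b : ℕ))⁻¹ * ζ ^ (c : ℕ) with hz
  have hsum : ((ifftMatrix N)ᴴ * ifftMatrix N) b c = (∑ a ∈ Finset.range N, z ^ a) / N := by
    rw [mul_apply, Finset.sum_range, Finset.sum_div]
    refine Finset.sum_congr rfl fun a _ => ?_
    rw [conjTranspose_apply, entry, entry, RCLike.star_def, map_div₀, map_pow, map_pow, hconj,
      Complex.conj_ofReal, div_mul_div_comm, hsq, hz, mul_pow, inv_pow]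
  rw [hsum]
  by_cases hbc : b = c
  · subst hbc
    have : z = 1 := inv_mul_cancel₀ (pow_ne_zero _ hζ0)
    simp [this, hN]
  · have hz1 : z ≠ 1 := by
      intro h
      rw [hz, inv_mul_eq_one₀ (pow_ne_zero _ hζ0)] at h
      exact hbc (Fin.ext (hprim.pow_inj b.2 c.2 h))
    have hzN : z ^ N = 1 := by
      have h (b : ℕ) : (ζ ^ b) ^ N = 1 := by rw [pow_right_comm, hprim.pow_eq_one, one_pow]
      rw [hz, mul_pow, inv_pow, h, h, inv_one, one_mul]
    rw [one_apply_ne hbc, geom_sum_eq hz1, hzN]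
    simp

lemma ifftMatrix_mul_conjTranspose_self : ifftMatrix N * (ifftMatrix N)ᴴ = 1 :=
  mul_eq_one_comm.mp ifftMatrix_conjTranspose_mul_self

/-- A cyclic shift by `l` multiplies a character by a phase; this makes the Fourier vectors
eigenvectors of circulant matrices. -/
lemma ifftMatrix_mul_of_modEq {i j l : ℕ} (k : ℕ) (h : j + l ≡ i [MOD N]) :
    Complex.exp (2 * Real.pi * Complex.I * j * k / N) =
      Complex.exp (2 * Real.pi * Complex.I * i * k / N) *
        Complex.exp (-(2 * Real.pi * Complex.I * l * k / N)) := by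
  have hN : (N : ℂ) ≠ 0 := Nat.cast_ne_zero.mpr (NeZero.ne N)
  rw [← Complex.exp_add, Complex.exp_eq_exp_iff_exists_int]
  obtain ⟨m, hm⟩ := Nat.modEq_iff_dvd.mp h.symm
  refine ⟨m * k, ?_⟩
  have hm' : (j : ℂ) + l - i = N * m := by exact_mod_cast hm
  have : (j : ℂ) = i - l + N * m := by linear_combination hm'
  rw [this]
  push_cast
  field_simp
  ring

/-- In each row of the circulant matrix, each tap contributes to exactly one column, even when the
impulse response is longer than `N`. -/
lemma Nat.existsUnique_fin_add_modEq (i l : ℕ) : ∃! j : Fin N, (j : ℕ) + l ≡ i [MOD N] := by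
  have hN : 0 < N := NeZero.pos N
  -- This is `i - l` modulo `N`, with `l` reduced first so that the natural subtraction does not
  -- truncate.
  refine ⟨⟨(i + (N - l % N)) % N, Nat.mod_lt _ hN⟩, ?_, fun j hj => ?_⟩
  · have hl := Nat.mod_lt l hN
    have h1 : (i + (N - l % N)) % N + l ≡ i + (N - l % N) + l % N [MOD N] :=
      (Nat.mod_modEq _ _).add (Nat.mod_modEq _ _).symm
    refine h1.trans ?_
    rw [show i + (N - l % N) + l % N = i + N by omega]
    simp [Nat.ModEq]
  · have hl := Nat.mod_lt l hN
    refine Fin.ext ?_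
    have h1 : (j : ℕ) + l + (N - l % N) ≡ i + (N - l % N) [MOD N] := hj.add_right _
    have h2 : (j : ℕ) + l + (N - l % N) ≡ (j : ℕ) + l % N + (N - l % N) [MOD N] :=
      ((Nat.ModEq.refl _).add (Nat.mod_modEq _ _).symm).add_right _
    have h3 : (j : ℕ) + l % N + (N - l % N) ≡ (j : ℕ) [MOD N] := by
      rw [show (j : ℕ) + l % N + (N - l % N) = (j : ℕ) + N by omega]
      simp [Nat.ModEq]
    have h4 : (j : ℕ) % N = (i + (N - l % N)) % N := (h3.symm.trans h2.symm).trans h1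
    rwa [Nat.mod_eq_of_lt j.2] at h4

end Fourier

/-! ### Diagonalization of the channels, the covariance and the gain matrix. -/

namespace LinkSystem

open Matrix

variable {Q N : ℕ} (S : LinkSystem Q N)

lemma pathLoss_pos (r q : Fin Q) : 0 < S.pathLoss r q := Real.rpow_pos_of_pos (S.dist_pos r q) _

/-- Interference-plus-noise power of user `q` on the `k`-th bin. -/
noncomputable def interfPower (p : Fin Q → Fin N → ℝ) (q : Fin Q) (k : Fin N) : ℝ :=
  S.noise q ^ 2 + ∑ r ∈ Finset.univ.erase q,
    S.power r * ‖S.freqResp r q k‖ ^ 2 * p r k / S.pathLoss r q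

/-- Channel power gain of link `q` on the `k`-th bin, relative to the interference-plus-noise. -/
noncomputable def chanGain (p : Fin Q → Fin N → ℝ) (q : Fin Q) (k : Fin N) : ℝ :=
  ‖S.freqResp q q k‖ ^ 2 / S.pathLoss q q / S.interfPower p q k

variable {S}

lemma interfPower_pos {p : Fin Q → Fin N → ℝ} {q : Fin Q}
    (hp : ∀ r, r ≠ q → ∀ k, 0 ≤ p r k) (k : Fin N) : 0 < S.interfPower p q k := by
  have h1 : 0 < S.noise q ^ 2 := pow_pos (S.noise_pos q) 2
  refine add_pos_of_pos_of_nonneg h1 (Finset.sum_nonneg fun r hr => ?_)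
  have h2 := hp r (Finset.ne_of_mem_erase hr) k
  have h3 := S.pathLoss_pos r q
  have h4 := S.power_pos r
  positivity

lemma chanGain_nonneg {p : Fin Q → Fin N → ℝ} {q : Fin Q}
    (hp : ∀ r, r ≠ q → ∀ k, 0 ≤ p r k) (k : Fin N) : 0 ≤ S.chanGain p q k := by
  have h1 := interfPower_pos (S := S) hp k
  have h2 := S.pathLoss_pos q q
  unfold chanGain
  positivity

lemma sinr_eq_chanGain (p : Fin Q → Fin N → ℝ) (q : Fin Q) (k : Fin N) :
    S.sinr p q k = S.chanGain p q k * (S.power q * p q k) := by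
  rw [sinr, chanGain, interfPower]
  ring

lemma chanGain_congr {p p' : Fin Q → Fin N → ℝ} {q : Fin Q} (h : ∀ r, r ≠ q → p r = p' r)
    (k : Fin N) : S.chanGain p q k = S.chanGain p' q k := by
  rw [chanGain, chanGain, interfPower, interfPower]
  congr 2
  refine Finset.sum_congr rfl fun r hr => ?_
  rw [h r (Finset.ne_of_mem_erase hr)]

variable [NeZero N]

/-- The columns of the IFFT matrix are eigenvectors of the circulant channel matrices. -/
lemma channel_mul_ifftMatrix (S : LinkSystem Q N) (r q : Fin Q) :
    S.channel r q * ifftMatrix N = ifftMatrix N *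
      diagonal fun k => S.freqResp r q k / (Real.sqrt (S.pathLoss r q) : ℂ) := by
  ext i k
  rw [mul_diagonal, mul_apply]
  simp only [channel, of_apply, Finset.sum_mul]
  rw [Finset.sum_comm, freqResp, Finset.sum_div, Finset.mul_sum]
  refine Finset.sum_congr rfl fun l _ => ?_
  obtain ⟨j, hj, huniq⟩ := Nat.existsUnique_fin_add_modEq (N := N) (i : ℕ) (l : ℕ)
  rw [Finset.sum_eq_single j]
  · rw [if_pos hj]
    simp only [ifftMatrix, of_apply]
    rw [ifftMatrix_mul_of_modEq (k : ℕ) hj]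
    ring
  · intro b _ hb
    rw [if_neg fun h => hb (huniq b h), zero_mul]
  · simp

lemma channel_eq (S : LinkSystem Q N) (r q : Fin Q) :
    S.channel r q = ifftMatrix N *
      (diagonal fun k => S.freqResp r q k / (Real.sqrt (S.pathLoss r q) : ℂ)) *
        (ifftMatrix N)ᴴ := by
  rw [← channel_mul_ifftMatrix, Matrix.mul_assoc, ifftMatrix_mul_conjTranspose_self,
    Matrix.mul_one]

/-- Each interferer's signal is diagonal in the Fourier basis, and white noise is diagonal in any
orthonormal basis. Nothing is required of the strategy of `q`, so the formula survives arbitrary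
deviations of `q`. -/
lemma interfCov_eq {F : Fin Q → Matrix (Fin N) (Fin N) ℂ} {p : Fin Q → Fin N → ℝ} {q : Fin Q}
    (hF : ∀ r, r ≠ q → F r = S.diagPrecoder p r) (hp : ∀ r, r ≠ q → ∀ k, 0 ≤ p r k) :
    S.interfCov F q = ifftMatrix N * (diagonal fun k => (S.interfPower p q k : ℂ)) *
      (ifftMatrix N)ᴴ := by
  have term (r : Fin Q) (hr : r ≠ q) :
      S.channel r q * F r * (F r)ᴴ * (S.channel r q)ᴴ = ifftMatrix N *
        (diagonal fun k => ((S.power r * ‖S.freqResp r q k‖ ^ 2 * p r k / S.pathLoss r q : ℝ) : ℂ))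
          * (ifftMatrix N)ᴴ := by
    have h1 : S.channel r q * F r = ifftMatrix N * diagonal fun k =>
        S.freqResp r q k / (Real.sqrt (S.pathLoss r q) : ℂ) *
          (Real.sqrt (S.power r * p r k) : ℂ) := by
      rw [hF r hr, diagPrecoder, ← Matrix.mul_assoc, channel_mul_ifftMatrix, Matrix.mul_assoc,
        diagonal_mul_diagonal]
    rw [Matrix.mul_assoc, ← conjTranspose_mul, h1, conjTranspose_mul, diagonal_conjTranspose,
      ← Matrix.mul_assoc, Matrix.mul_assoc (ifftMatrix N), diagonal_mul_diagonal]
    congr 3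
    ext k
    have h2 : (Real.sqrt (S.power r * p r k) : ℂ) * (Real.sqrt (S.power r * p r k) : ℂ) =
        ((S.power r * p r k : ℝ) : ℂ) := by
      rw [← Complex.ofReal_mul,
        Real.mul_self_sqrt (mul_nonneg (S.power_pos r).le (hp r hr k))]
    have h3 : (Real.sqrt (S.pathLoss r q) : ℂ) * (Real.sqrt (S.pathLoss r q) : ℂ) =
        ((S.pathLoss r q : ℝ) : ℂ) := by
      rw [← Complex.ofReal_mul, Real.mul_self_sqrt (S.pathLoss_pos r q).le]
    have h4 : S.freqResp r q k * (starRingEnd ℂ) (S.freqResp r q k) =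
        ((‖S.freqResp r q k‖ ^ 2 : ℝ) : ℂ) := by
      rw [Complex.mul_conj, Complex.normSq_eq_norm_sq]
    simp only [Pi.star_apply, RCLike.star_def, map_mul, map_div₀, Complex.conj_ofReal]
    calc _ = S.freqResp r q k * (starRingEnd ℂ) (S.freqResp r q k) *
          ((Real.sqrt (S.power r * p r k) : ℂ) * (Real.sqrt (S.power r * p r k) : ℂ)) /
          ((Real.sqrt (S.pathLoss r q) : ℂ) * (Real.sqrt (S.pathLoss r q) : ℂ)) := by ring
      _ = _ := by
        rw [h2, h3, h4]
        push_cast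
        ring
  rw [interfCov, Finset.sum_congr rfl fun r hr => term r (Finset.ne_of_mem_erase hr),
    ← Finset.sum_mul, ← Finset.mul_sum]
  have hone : ((S.noise q ^ 2 : ℝ) : ℂ) • (1 : Matrix (Fin N) (Fin N) ℂ) =
      ifftMatrix N * (diagonal fun _ => ((S.noise q ^ 2 : ℝ) : ℂ)) * (ifftMatrix N)ᴴ := by
    rw [← smul_one_eq_diagonal, Matrix.mul_smul, Matrix.mul_one, Matrix.smul_mul,
      ifftMatrix_mul_conjTranspose_self]
  rw [hone, ← Matrix.add_mul, ← Matrix.mul_add]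
  congr 2
  ext i j
  rw [Matrix.add_apply, Matrix.sum_apply]
  by_cases h : i = j
  · subst h
    simp only [diagonal_apply_eq, interfPower]
    push_cast
    rfl
  · simp [diagonal_apply_ne _ h]

/-- Against diagonal precoders, the gain matrix of user `q` depends on its own precoder through a
diagonal quadratic form in the frequency domain. -/
lemma gainMatrix_eq {F : Fin Q → Matrix (Fin N) (Fin N) ℂ} {p : Fin Q → Fin N → ℝ} {q : Fin Q}
    (hF : ∀ r, r ≠ q → F r = S.diagPrecoder p r) (hp : ∀ r, r ≠ q → ∀ k, 0 ≤ p r k) :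
    S.gainMatrix F q = 1 + ((ifftMatrix N)ᴴ * F q)ᴴ *
      (diagonal fun k => (S.chanGain p q k : ℂ)) * ((ifftMatrix N)ᴴ * F q) := by
  have hW := ifftMatrix_conjTranspose_mul_self (N := N)
  set W := ifftMatrix N with hWdef
  set D : Matrix (Fin N) (Fin N) ℂ :=
    diagonal fun k => S.freqResp q q k / (Real.sqrt (S.pathLoss q q) : ℂ) with hD
  have hinv : (S.interfCov F q)⁻¹ =
      W * (diagonal fun k => ((S.interfPower p q k)⁻¹ : ℂ)) * Wᴴ := by
    refine inv_eq_right_inv ?_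
    rw [interfCov_eq hF hp, ← hWdef]
    calc _ = W * ((diagonal fun k => (S.interfPower p q k : ℂ)) * (Wᴴ * W) *
          diagonal fun k => ((S.interfPower p q k)⁻¹ : ℂ)) * Wᴴ := by
            simp only [Matrix.mul_assoc]
      _ = 1 := by
        have h1 : (fun k => (S.interfPower p q k : ℂ) * ((S.interfPower p q k)⁻¹ : ℂ)) =
            fun _ => 1 := by
          ext k
          exact mul_inv_cancel₀ (Complex.ofReal_ne_zero.mpr (interfPower_pos hp k).ne')
        rw [hW, Matrix.mul_one, diagonal_mul_diagonal, h1, diagonal_one, Matrix.mul_one]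
        exact ifftMatrix_mul_conjTranspose_self
  -- Phases of the direct channel cancel against their conjugates, so only real gains remain.
  have hdiag : Dᴴ * (diagonal fun k => ((S.interfPower p q k)⁻¹ : ℂ)) * D =
      diagonal fun k => (S.chanGain p q k : ℂ) := by
    rw [hD, diagonal_conjTranspose, diagonal_mul_diagonal, diagonal_mul_diagonal]
    congr 1
    ext k
    have h3 : (Real.sqrt (S.pathLoss q q) : ℂ) * (Real.sqrt (S.pathLoss q q) : ℂ) =
        ((S.pathLoss q q : ℝ) : ℂ) := by
      rw [← Complex.ofReal_mul, Real.mul_self_sqrt (S.pathLoss_pos q q).le]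
    have h4 : S.freqResp q q k * (starRingEnd ℂ) (S.freqResp q q k) =
        ((‖S.freqResp q q k‖ ^ 2 : ℝ) : ℂ) := by
      rw [Complex.mul_conj, Complex.normSq_eq_norm_sq]
    simp only [Pi.star_apply, RCLike.star_def, map_div₀, Complex.conj_ofReal]
    calc _ = S.freqResp q q k * (starRingEnd ℂ) (S.freqResp q q k) /
          ((Real.sqrt (S.pathLoss q q) : ℂ) * (Real.sqrt (S.pathLoss q q) : ℂ)) /
          (S.interfPower p q k : ℂ) := by ring
      _ = _ := by
        rw [h3, h4, chanGain]
        push_cast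
        ring
  rw [gainMatrix, hinv, channel_eq, ← hWdef, ← hD, ← hdiag]
  congr 1
  simp only [conjTranspose_mul, conjTranspose_conjTranspose]
  calc _ = (F q)ᴴ * W * Dᴴ * (Wᴴ * W) * (diagonal fun k => ((S.interfPower p q k)⁻¹ : ℂ)) *
        (Wᴴ * W) * D * Wᴴ * F q := by simp only [Matrix.mul_assoc]
    _ = _ := by rw [hW, Matrix.mul_one, Matrix.mul_one]; simp only [Matrix.mul_assoc]

end LinkSystem

/-! ### Comparison of payoffs, admissibility and best responses. -/

namespace LinkSystem

open Matrix

variable {Q N : ℕ} {S : LinkSystem Q N}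

lemma sinr_eq_normResp (p : Fin Q → Fin N → ℝ) (q : Fin Q) (k : Fin N) :
    S.sinr p q k = ‖S.normResp q q k‖ ^ 2 * p q k /
      (1 + ∑ r ∈ Finset.univ.erase q, ‖S.normResp r q k‖ ^ 2 * p r k) := by
  have hσ : S.noise q ^ 2 ≠ 0 := (pow_pos (S.noise_pos q) 2).ne'
  have term (r : Fin Q) : ‖S.normResp r q k‖ ^ 2 * p r k =
      S.power r * ‖S.freqResp r q k‖ ^ 2 * p r k / S.pathLoss r q / S.noise q ^ 2 := by
    have h1 := S.power_pos r
    have h2 := S.pathLoss_pos r q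
    rw [normResp, norm_mul, mul_pow, Complex.norm_real, Real.norm_eq_abs, sq_abs,
      Real.sq_sqrt (by positivity)]
    field_simp
  rw [Finset.sum_congr rfl fun r _ => term r, term, ← Finset.sum_div, sinr, ← div_self hσ,
    ← add_div, div_div_div_cancel_right₀ hσ]

/-- The gain depends only on the other users, so a deviation changes the SINR linearly. -/
lemma sinr_update (p : Fin Q → Fin N → ℝ) (q : Fin Q) (y : Fin N → ℝ) (k : Fin N) :
    S.sinr (Function.update p q y) q k = S.chanGain p q k * (S.power q * y k) := by
  rw [sinr_eq_chanGain, Function.update_self,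
    chanGain_congr fun r hr => Function.update_of_ne hr _ _]

lemma game1_payoff (F : Fin Q → Matrix (Fin N) (Fin N) ℂ) (q : Fin Q) :
    S.game1.payoff q F = 1 / N * Real.log (S.gainMatrix F q).det.re := rfl

lemma game2_payoff (Γ : Fin Q → ℝ) (F : Fin Q → Matrix (Fin N) (Fin N) ℂ) (q : Fin Q) :
    (S.game2 Γ).payoff q F = 1 / N * ∑ k, Real.logb 2 (1 + S.mmseSINR F q k / Γ q) := rfl

lemma vectorGame_payoff (Γ : Fin Q → ℝ) (p : Fin Q → Fin N → ℝ) (q : Fin Q) :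
    (S.vectorGame Γ).payoff q p =
      1 / N * ∑ k, Real.log (1 + 1 / Γ q * S.chanGain p q k * (S.power q * p q k)) := by
  simp only [vectorGame, sinr_eq_chanGain, mul_assoc]

lemma vectorGame_payoff_update (Γ : Fin Q → ℝ) (p : Fin Q → Fin N → ℝ) (q : Fin Q)
    (y : Fin N → ℝ) :
    (S.vectorGame Γ).payoff q (Function.update p q y) =
      1 / N * ∑ k, Real.log (1 + 1 / Γ q * S.chanGain p q k * (S.power q * y k)) := by
  simp only [vectorGame, sinr_update, mul_assoc]

/-- Best responses exist in the vector game. -/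
lemma exists_isBestResponse_vectorGame {Γ : Fin Q → ℝ} (hΓ : ∀ q, 0 < Γ q)
    {p : Fin Q → Fin N → ℝ} (hp : ∀ q k, 0 ≤ p q k) (q : Fin Q) :
    ∃ y, (S.vectorGame Γ).IsBestResponse (Function.update p q y) q := by
  have hcompact : IsCompact (S.allocations q) := by
    have hbox : S.allocations q ⊆ Set.Icc 0 fun k => S.mask q k / S.power q :=
      fun y hy => ⟨fun k => (hy.2 k).1, fun k => (hy.2 k).2⟩
    refine isCompact_Icc.of_isClosed_subset ?_ hbox
    have : S.allocations q = {y : Fin N → ℝ | 1 / N * ∑ k, y k ≤ 1} ∩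
        ⋂ k, ({y : Fin N → ℝ | 0 ≤ y k} ∩ {y | y k ≤ S.mask q k / S.power q}) := by
      ext y
      simp [allocations]
    rw [this]
    refine (isClosed_le (by fun_prop) continuous_const).inter (isClosed_iInter fun k => ?_)
    exact (isClosed_le continuous_const (by fun_prop)).inter
      (isClosed_le (by fun_prop) continuous_const)
  have hne : (S.allocations q).Nonempty :=
    ⟨0, by simp, fun k => ⟨le_rfl, div_nonneg (S.mask_nonneg q k) (S.power_pos q).le⟩⟩
  have hcont : ContinuousOn (fun y => (S.vectorGame Γ).payoff q (Function.update p q y))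
      (S.allocations q) := by
    simp only [vectorGame_payoff_update]
    refine continuousOn_const.mul (continuousOn_finsetSum _ fun k _ => ?_)
    -- Admissible powers are nonnegative, which keeps the argument of the logarithm away from its
    -- singularity at `0`.
    refine ContinuousOn.log (by fun_prop) fun y hy => ?_
    have h1 := chanGain_nonneg (S := S) (fun r (_ : r ≠ q) => hp r) k
    have h2 := hΓ q
    have h3 := S.power_pos q
    have h4 := (hy.2 k).1
    positivity
  obtain ⟨y, hy, hmax⟩ := hcompact.exists_isMaxOn hne hcont
  refine ⟨y, by simpa [vectorGame] using hy, fun z hz => ?_⟩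
  rw [Function.update_idem]
  exact hmax hz

lemma diagPrecoder_update (p : Fin Q → Fin N → ℝ) (q : Fin Q) (y : Fin N → ℝ) :
    S.diagPrecoder (Function.update p q y) =
      Function.update (S.diagPrecoder p) q (S.diagPrecoder (Function.update p q y) q) := by
  ext1 r
  by_cases hr : r = q
  · subst hr
    simp
  · simp [diagPrecoder, Function.update_of_ne hr]

/-- Normalized power that the precoder `F` of user `q` puts on the `k`-th bin. -/
noncomputable def binPower (S : LinkSystem Q N) (q : Fin Q) (F : Matrix (Fin N) (Fin N) ℂ)
    (k : Fin N) : ℝ :=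
  ((((ifftMatrix N)ᴴ * F) * ((ifftMatrix N)ᴴ * F)ᴴ) k k).re / S.power q

lemma power_mul_binPower (q : Fin Q) (F : Matrix (Fin N) (Fin N) ℂ) (k : Fin N) :
    S.power q * S.binPower q F k =
      ((((ifftMatrix N)ᴴ * F) * ((ifftMatrix N)ᴴ * F)ᴴ) k k).re :=
  mul_div_cancel₀ _ (S.power_pos q).ne'

open scoped ComplexOrder in
lemma binPower_nonneg (q : Fin Q) (F : Matrix (Fin N) (Fin N) ℂ) (k : Fin N) :
    0 ≤ S.binPower q F k :=
  div_nonneg (Complex.nonneg_iff.mp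
    (posSemidef_self_mul_conjTranspose ((ifftMatrix N)ᴴ * F)).diag_nonneg).1 (S.power_pos q).le

lemma one_add_chanGain_mul_pos {p : Fin Q → Fin N → ℝ} (hp : ∀ q k, 0 ≤ p q k) (q : Fin Q)
    (k : Fin N) : 0 < 1 + S.chanGain p q k * (S.power q * p q k) := by
  have h1 := chanGain_nonneg (S := S) (fun r (_ : r ≠ q) => hp r) k
  have h2 := mul_nonneg h1 (mul_nonneg (S.power_pos q).le (hp q k))
  linarith

variable [NeZero N]

lemma conjTranspose_ifftMatrix_mul_diagPrecoder (p : Fin Q → Fin N → ℝ) (q : Fin Q) :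
    (ifftMatrix N)ᴴ * S.diagPrecoder p q =
      diagonal fun k => (Real.sqrt (S.power q * p q k) : ℂ) := by
  rw [diagPrecoder, ← Matrix.mul_assoc, ifftMatrix_conjTranspose_mul_self, Matrix.one_mul]

lemma binPower_diagPrecoder {p : Fin Q → Fin N → ℝ} {q : Fin Q} (hp : ∀ k, 0 ≤ p q k) :
    S.binPower q (S.diagPrecoder p q) = p q := by
  ext k
  have h := mul_nonneg (S.power_pos q).le (hp k)
  refine mul_left_cancel₀ (S.power_pos q).ne' ?_
  rw [power_mul_binPower, conjTranspose_ifftMatrix_mul_diagPrecoder, diagonal_conjTranspose,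
    diagonal_mul_diagonal, diagonal_apply_eq, Pi.star_apply, RCLike.star_def,
    Complex.conj_ofReal, ← Complex.ofReal_mul, Real.mul_self_sqrt h, Complex.ofReal_re]

/-- The admissibility of a precoder depends only on the powers which it puts on the bins. -/
lemma mem_precoders_iff (q : Fin Q) (F : Matrix (Fin N) (Fin N) ℂ) :
    F ∈ S.precoders q ↔ S.binPower q F ∈ S.allocations q := by
  have hP := S.power_pos q
  have htrace : (F * Fᴴ).trace.re = S.power q * ∑ k, S.binPower q F k := by
    have h : (F * Fᴴ).trace = (((ifftMatrix N)ᴴ * F) * ((ifftMatrix N)ᴴ * F)ᴴ).trace := by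
      rw [conjTranspose_mul, conjTranspose_conjTranspose, ← Matrix.mul_assoc,
        trace_mul_comm ((ifftMatrix N)ᴴ * F * Fᴴ),
        ← Matrix.mul_assoc, ← Matrix.mul_assoc, ifftMatrix_mul_conjTranspose_self,
        Matrix.one_mul]
    rw [h, Finset.mul_sum, trace, Complex.re_sum]
    exact Finset.sum_congr rfl fun k _ => (power_mul_binPower q F k).symm
  have hmask (k : Fin N) : (((ifftMatrix N)ᴴ * F * Fᴴ * ifftMatrix N) k k).re =
      S.power q * S.binPower q F k := by
    rw [power_mul_binPower, conjTranspose_mul, conjTranspose_conjTranspose]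
    simp only [Matrix.mul_assoc]
  simp only [precoders, allocations, Set.mem_ofPred_eq, htrace, hmask, binPower_nonneg, true_and]
  refine and_congr ?_ (forall_congr' fun k => ?_)
  · rw [mul_left_comm]
    exact mul_le_iff_le_one_right hP
  · rw [le_div_iff₀' hP]

lemma diagPrecoder_mem_precoders_iff {p : Fin Q → Fin N → ℝ} {q : Fin Q}
    (hp : ∀ k, 0 ≤ p q k) : S.diagPrecoder p q ∈ S.precoders q ↔ p q ∈ S.allocations q := by
  rw [mem_precoders_iff, binPower_diagPrecoder hp]

/-- When `q` also uses a diagonal precoder the substreams decouple, and both matrix payoffs can be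
read off the diagonal. -/
lemma gainMatrix_diagPrecoder {p : Fin Q → Fin N → ℝ} (hp : ∀ q k, 0 ≤ p q k) (q : Fin Q) :
    S.gainMatrix (S.diagPrecoder p) q =
      diagonal fun k => ((1 + S.chanGain p q k * (S.power q * p q k) : ℝ) : ℂ) := by
  rw [gainMatrix_eq (fun _ _ => rfl) fun r _ => hp r, conjTranspose_ifftMatrix_mul_diagPrecoder,
    diagonal_conjTranspose, diagonal_mul_diagonal, diagonal_mul_diagonal, ← diagonal_one,
    diagonal_add]
  congr 1
  ext k
  have h := mul_nonneg (S.power_pos q).le (hp q k)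
  rw [Pi.star_apply, RCLike.star_def, Complex.conj_ofReal, mul_right_comm, ← Complex.ofReal_mul,
    Real.mul_self_sqrt h]
  push_cast
  ring

lemma game1_payoff_diagPrecoder {p : Fin Q → Fin N → ℝ} (hp : ∀ q k, 0 ≤ p q k) (q : Fin Q) :
    S.game1.payoff q (S.diagPrecoder p) = (S.vectorGame 1).payoff q p := by
  have hdet : (S.gainMatrix (S.diagPrecoder p) q).det.re =
      ∏ k, (1 + S.chanGain p q k * (S.power q * p q k)) := by
    rw [gainMatrix_diagPrecoder hp, det_diagonal]
    exact_mod_cast Complex.ofReal_re (∏ k, (1 + S.chanGain p q k * (S.power q * p q k)))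
  rw [vectorGame_payoff, game1_payoff, hdet,
    Real.log_prod fun k _ => (one_add_chanGain_mul_pos hp q k).ne']
  simp

lemma game2_payoff_diagPrecoder (Γ : Fin Q → ℝ) {p : Fin Q → Fin N → ℝ}
    (hp : ∀ q k, 0 ≤ p q k) (q : Fin Q) :
    (S.game2 Γ).payoff q (S.diagPrecoder p) = (S.vectorGame Γ).payoff q p / Real.log 2 := by
  have hinv : (S.gainMatrix (S.diagPrecoder p) q)⁻¹ =
      diagonal fun k => (((1 + S.chanGain p q k * (S.power q * p q k))⁻¹ : ℝ) : ℂ) := by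
    refine inv_eq_right_inv ?_
    rw [gainMatrix_diagPrecoder hp, diagonal_mul_diagonal, ← diagonal_one]
    congr 1
    ext k
    rw [← Complex.ofReal_mul, mul_inv_cancel₀ (one_add_chanGain_mul_pos hp q k).ne',
      Complex.ofReal_one]
  rw [vectorGame_payoff, game2_payoff, mul_div_assoc, Finset.sum_div]
  congr 1
  refine Finset.sum_congr rfl fun k _ => ?_
  rw [Real.logb, mmseSINR, hinv, diagonal_apply_eq, Complex.ofReal_re, one_div, inv_inv]
  congr 2
  ring

lemma gainMatrix_update {p : Fin Q → Fin N → ℝ} (hp : ∀ q k, 0 ≤ p q k) (q : Fin Q)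
    (Y : Matrix (Fin N) (Fin N) ℂ) :
    S.gainMatrix (Function.update (S.diagPrecoder p) q Y) q = 1 + ((ifftMatrix N)ᴴ * Y)ᴴ *
      (diagonal fun k => (S.chanGain p q k : ℂ)) * ((ifftMatrix N)ᴴ * Y) := by
  rw [gainMatrix_eq (fun r hr => Function.update_of_ne hr _ _) fun r _ => hp r,
    Function.update_self]

/-- Diagonal precoders with the same powers on the bins do not decrease the mutual information. -/
lemma game1_payoff_update_le {p : Fin Q → Fin N → ℝ} (hp : ∀ q k, 0 ≤ p q k) (q : Fin Q)
    (Y : Matrix (Fin N) (Fin N) ℂ) :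
    S.game1.payoff q (Function.update (S.diagPrecoder p) q Y) ≤
      (S.vectorGame 1).payoff q (Function.update p q (S.binPower q Y)) := by
  rw [vectorGame_payoff_update, game1_payoff, gainMatrix_update hp]
  refine mul_le_mul_of_nonneg_left ?_ (by positivity)
  refine (log_det_one_add_conjTranspose_mul_diagonal_mul_le _
    (chanGain_nonneg fun r (_ : r ≠ q) => hp r)).trans_eq ?_
  simp [power_mul_binPower]

open scoped ComplexOrder in
/-- Diagonal precoders with the same powers on the bins do not decrease the transmission rate. -/
lemma game2_payoff_update_le {Γ : Fin Q → ℝ} (hΓ : ∀ q, 1 ≤ Γ q) {p : Fin Q → Fin N → ℝ}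
    (hp : ∀ q k, 0 ≤ p q k) (q : Fin Q) (Y : Matrix (Fin N) (Fin N) ℂ) :
    (S.game2 Γ).payoff q (Function.update (S.diagPrecoder p) q Y) ≤
      (S.vectorGame Γ).payoff q (Function.update p q (S.binPower q Y)) / Real.log 2 := by
  have hgain (k : Fin N) : 0 ≤ S.chanGain p q k := chanGain_nonneg (fun r (_ : r ≠ q) => hp r) k
  have hΓ0 : 0 < Γ q := by linarith [hΓ q]
  set G := (ifftMatrix N)ᴴ * Y with hG
  set D : Matrix (Fin N) (Fin N) ℂ := diagonal fun k => (S.chanGain p q k : ℂ) with hD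
  have hK : (Gᴴ * D * G).PosSemidef := by
    refine PosSemidef.conjTranspose_mul_mul_same (PosSemidef.diagonal fun k => ?_) G
    exact Complex.zero_le_real.mpr (hgain k)
  -- The gap is absorbed into the channel gains, so the determinant bound for mutual information
  -- applies again.
  have hscale : ((1 / Γ q : ℝ) : ℂ) • (Gᴴ * D * G) =
      Gᴴ * (diagonal fun k => ((1 / Γ q * S.chanGain p q k : ℝ) : ℂ)) * G := by
    have : (diagonal fun k => ((1 / Γ q * S.chanGain p q k : ℝ) : ℂ)) =
        ((1 / Γ q : ℝ) : ℂ) • D := by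
      rw [hD, ← diagonal_smul]
      congr 1
      ext k
      simp
    rw [this, Matrix.mul_smul, Matrix.smul_mul]
  have key : ∑ k, Real.log (1 + S.mmseSINR (Function.update (S.diagPrecoder p) q Y) q k / Γ q) ≤
      ∑ k, Real.log (1 + 1 / Γ q * S.chanGain p q k * (S.power q * S.binPower q Y k)) := by
    simp only [mmseSINR, gainMatrix_update hp, ← hG, ← hD, power_mul_binPower]
    refine (hK.sum_log_gap_le_log_det (hΓ q)).trans ?_
    rw [hscale]
    exact log_det_one_add_conjTranspose_mul_diagonal_mul_le G
      fun k => mul_nonneg (by positivity) (hgain k)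
  rw [vectorGame_payoff_update, game2_payoff, mul_div_assoc]
  refine mul_le_mul_of_nonneg_left ?_ (by positivity)
  simp only [Real.logb, ← Finset.sum_div]
  exact div_le_div_of_nonneg_right key (Real.log_nonneg one_le_two)

/-- Let the payoffs of a matrix game be those of the vector game, in another unit, at diagonal
precoders, and let no precoder beat the diagonal one with the same powers on the bins. Then best
responses and equilibria among diagonal precoders are those of the vector game, and diagonal best
responses exist. -/
lemma optimality_of_payoff_le
    {G : StrategicGame (Fin Q) (Matrix (Fin N) (Fin N) ℂ)} {Γ : Fin Q → ℝ} {c : ℝ}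
    (hΓ : ∀ q, 0 < Γ q) (hc : 0 < c) (hstrat : G.strategies = S.precoders)
    (heq : ∀ p : Fin Q → Fin N → ℝ, (∀ q k, 0 ≤ p q k) → ∀ q,
      G.payoff q (S.diagPrecoder p) = (S.vectorGame Γ).payoff q p / c)
    (hle : ∀ p : Fin Q → Fin N → ℝ, (∀ q k, 0 ≤ p q k) → ∀ q Y,
      G.payoff q (Function.update (S.diagPrecoder p) q Y) ≤
        (S.vectorGame Γ).payoff q (Function.update p q (S.binPower q Y)) / c) :
    (∀ p : Fin Q → Fin N → ℝ, (∀ q k, 0 ≤ p q k) →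
      (∀ q, G.payoff q (S.diagPrecoder p) = (S.vectorGame Γ).payoff q p / c) ∧
      (∀ q, G.IsBestResponse (S.diagPrecoder p) q ↔ (S.vectorGame Γ).IsBestResponse p q) ∧
      (G.IsNash (S.diagPrecoder p) ↔ (S.vectorGame Γ).IsNash p)) ∧
    (∀ p : Fin Q → Fin N → ℝ, (∀ q, p q ∈ S.allocations q) → ∀ q, ∃ y : Fin N → ℝ,
      (S.vectorGame Γ).IsBestResponse (Function.update p q y) q ∧
      G.IsBestResponse (S.diagPrecoder (Function.update p q y)) q) := by
  have nonneg_update {p : Fin Q → Fin N → ℝ} (hp : ∀ q k, 0 ≤ p q k) (q : Fin Q)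
      {y : Fin N → ℝ} (hy : y ∈ S.allocations q) (r : Fin Q) (k : Fin N) :
      0 ≤ Function.update p q y r k := by
    by_cases hr : r = q
    · subst hr
      simpa using (hy.2 k).1
    · simpa [Function.update_of_ne hr] using hp r k
  have hbest (p : Fin Q → Fin N → ℝ) (hp : ∀ q k, 0 ≤ p q k) (q : Fin Q) :
      G.IsBestResponse (S.diagPrecoder p) q ↔ (S.vectorGame Γ).IsBestResponse p q := by
    rw [StrategicGame.IsBestResponse, StrategicGame.IsBestResponse, hstrat,
      diagPrecoder_mem_precoders_iff (hp q)]
    refine and_congr Iff.rfl ⟨fun h y hy => ?_, fun h Y hY => ?_⟩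
    -- A vector deviation is tested through its diagonal precoder.
    · have hy' := nonneg_update hp q hy
      have h1 := h (S.diagPrecoder (Function.update p q y) q)
        ((diagPrecoder_mem_precoders_iff (hy' q)).mpr (by simpa [vectorGame] using hy))
      rwa [← diagPrecoder_update, heq _ hy', heq p hp, div_le_div_iff_of_pos_right hc] at h1
    -- A matrix deviation is dominated through its bin powers, which are an admissible vector
    -- deviation.
    · refine (hle p hp q Y).trans ?_
      rw [heq p hp, div_le_div_iff_of_pos_right hc]
      exact h _ ((mem_precoders_iff q Y).mp hY)
  refine ⟨fun p hp => ⟨heq p hp, hbest p hp, forall_congr' (hbest p hp)⟩, fun p hp q => ?_⟩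
  have hp' (r : Fin Q) (k : Fin N) : 0 ≤ p r k := ((hp r).2 k).1
  obtain ⟨y, hy⟩ := exists_isBestResponse_vectorGame (S := S) hΓ hp' q
  refine ⟨y, hy, (hbest _ (nonneg_update hp' q ?_) q).mpr hy⟩
  simpa [vectorGame] using hy.1

end LinkSystem

theorem theorem1 {Q N : ℕ} [NeZero N] (S : LinkSystem Q N) (Γ : Fin Q → ℝ)
    (hΓ : ∀ q, 1 ≤ Γ q) :
    -- the diagonal precoders are admissible exactly when the power allocations are
    (∀ p : Fin Q → Fin N → ℝ, (∀ q k, 0 ≤ p q k) →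
      ∀ q, S.diagPrecoder p q ∈ S.precoders q ↔ p q ∈ S.allocations q) ∧
    -- the two forms of the SINR
    (∀ (p : Fin Q → Fin N → ℝ) (q : Fin Q) (k : Fin N),
      S.sinr p q k = ‖S.normResp q q k‖ ^ 2 * p q k /
        (1 + ∑ r ∈ Finset.univ.erase q, ‖S.normResp r q k‖ ^ 2 * p r k)) ∧
    -- mutual information game: same payoffs, same optimal responses, same equilibria
    ((∀ p : Fin Q → Fin N → ℝ, (∀ q k, 0 ≤ p q k) →
        (∀ q, S.game1.payoff q (S.diagPrecoder p) = (S.vectorGame 1).payoff q p) ∧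
        (∀ q, S.game1.IsBestResponse (S.diagPrecoder p) q ↔
          (S.vectorGame 1).IsBestResponse p q) ∧
        (S.game1.IsNash (S.diagPrecoder p) ↔ (S.vectorGame 1).IsNash p)) ∧
      -- against diagonal precoders there is always a diagonal optimal precoder
      (∀ p : Fin Q → Fin N → ℝ, (∀ q, p q ∈ S.allocations q) → ∀ q, ∃ y : Fin N → ℝ,
        (S.vectorGame 1).IsBestResponse (Function.update p q y) q ∧
        S.game1.IsBestResponse (S.diagPrecoder (Function.update p q y)) q)) ∧
    -- transmission rate game: the same, with rates in bits in the matrix game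
    ((∀ p : Fin Q → Fin N → ℝ, (∀ q k, 0 ≤ p q k) →
        (∀ q, (S.game2 Γ).payoff q (S.diagPrecoder p) =
          (S.vectorGame Γ).payoff q p / Real.log 2) ∧
        (∀ q, (S.game2 Γ).IsBestResponse (S.diagPrecoder p) q ↔
          (S.vectorGame Γ).IsBestResponse p q) ∧
        ((S.game2 Γ).IsNash (S.diagPrecoder p) ↔ (S.vectorGame Γ).IsNash p)) ∧
      (∀ p : Fin Q → Fin N → ℝ, (∀ q, p q ∈ S.allocations q) → ∀ q, ∃ y : Fin N → ℝ,
        (S.vectorGame Γ).IsBestResponse (Function.update p q y) q ∧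
        (S.game2 Γ).IsBestResponse (S.diagPrecoder (Function.update p q y)) q)) := by
  refine ⟨fun p hp q => LinkSystem.diagPrecoder_mem_precoders_iff (hp q),
    LinkSystem.sinr_eq_normResp, ?_, ?_⟩
  -- The constant `c` converts units: `1` for nats here, `Real.log 2` for bits in the second game.
  · have h := LinkSystem.optimality_of_payoff_le (S := S) (G := S.game1) (Γ := 1) (c := 1)
      (fun _ => one_pos) one_pos rfl
      (fun p hp q => by rw [div_one]; exact LinkSystem.game1_payoff_diagPrecoder hp q)
      (fun p hp q Y => by rw [div_one]; exact LinkSystem.game1_payoff_update_le hp q Y)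
    simpa only [div_one] using h
  · exact LinkSystem.optimality_of_payoff_le (fun q => one_pos.trans_le (hΓ q))
      (Real.log_pos one_lt_two) rfl (fun p hp q => LinkSystem.game2_payoff_diagPrecoder Γ hp q)
      (fun p hp q Y => LinkSystem.game2_payoff_update_le hΓ hp q Y)
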